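/- **Theorem 2.5.** For integers $t,k,n\ge 1$, an $S_p(t,k,n)$ partial Steiner system is a collection $\mathcal S$ of $k$-element subsets of $\{1,\dots,n\}$ such that every $t$-element subset of $\{1,\dots,n\}$ is contained in at most one member of $\mathcal S$. For $J\subseteq\{1,\dots,n\}$ write $z_J=\prod_{j\in J}z_j$, and for a $k$-homogeneous polynomial $p$ in $n$ complex variables and $1\le q<\infty$ put $$\|p\|_{\mathcal P({}^k\ell_q^n)}=\sup\Big\{|p(z)| : z\in\mathbb C^n,\ \Big(\sum_{i=1}^n|z_i|^q\Big)^{1/q}\le 1\Big\}.$$ There are constants $A_{k,q}>0$ ($k\ge 2$ an integer, $1\le q<\infty$ real), depending only on $k$ and $q$, and for $q\ne 2$ depending only on $q$, such that the following holds. For all integers $k\ge 2$ and $n\ge 1$ and every $S_p(k-1,k,n)$ partial Steiner system $\mathcal S$ there are signs $c_J\in\{-1,1\}$ $(J\in\mathcal S)$ such that the $k$-homogeneous polynomial $p(z)=\sum_{J\in\mathcal S}c_J z_J$ satisfies, simultaneously for all $q\in[1,\infty)$, $$\|p\|_{\mathcal P({}^k\ell_q^n)}\le A_{k,q}\,(\log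 n)^{3/q}\,n^{\frac k2\cdot\frac{q-2}{q}}\quad\text{if } 2\le q<\infty,$$ $$\|p\|_{\mathcal P({}^k\ell_q^n)}\le A_{k,q}\,(\log n)^{(3q-3)/q}\quad\text{if } 1\le q\le 2.$$ -/

import Mathlib

open scoped ENNReal

/-- An `S_p(t, k, n)` partial Steiner system: a collection `S` of `k`-element subsets of an
`n`-element set such that every `t`-element subset is contained in at most one member of `S`. -/
def IsPartialSteinerSystem (t k n : ℕ) (S : Finset (Finset (Fin n))) : Prop :=
  (∀ J ∈ S, J.card = k) ∧
    ∀ T : Finset (Fin n), T.card = t → ∀ I ∈ S, ∀ J ∈ S, T ⊆ I → T ⊆ J → I = J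

/-- The polynomial `∑_{J ∈ S} c_J z_J` in `n` complex variables, where `z_J = ∏_{j ∈ J} z_j`. -/
noncomputable def steinerPolynomial {n : ℕ} (S : Finset (Finset (Fin n)))
    (c : Finset (Fin n) → ℤ) : MvPolynomial (Fin n) ℂ :=
  ∑ J ∈ S, MvPolynomial.C (c J : ℂ) * ∏ j ∈ J, MvPolynomial.X j

/-- The norm `sup {|p(z)| : ‖z‖_q ≤ 1}` of a polynomial on `ℓ_q^n`, that is, on `ℂⁿ` with the
`q`-norm. The supremum is that of a nonempty bounded set when `1 ≤ q`, see `polyNorm_bddAbove`. -/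
noncomputable def polyNorm {n : ℕ} (q : ℝ≥0∞) (p : MvPolynomial (Fin n) ℂ) : ℝ :=
  sSup {r : ℝ | ∃ z : PiLp q (fun _ : Fin n => ℂ), ‖z‖ ≤ 1 ∧ r = ‖MvPolynomial.eval (fun i => z i) p‖}

theorem polyNorm_bddAbove {n : ℕ} {q : ℝ≥0∞} (hq : 1 ≤ q) (p : MvPolynomial (Fin n) ℂ) :
    BddAbove {r : ℝ | ∃ z : PiLp q (fun _ : Fin n => ℂ),
      ‖z‖ ≤ 1 ∧ r = ‖MvPolynomial.eval (fun i => z i) p‖} := by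
  have : Fact (1 ≤ q) := ⟨hq⟩
  refine ⟨∑ d ∈ p.support, ‖p.coeff d‖, ?_⟩
  rintro r ⟨z, hz, rfl⟩
  rw [MvPolynomial.eval_eq]
  refine (norm_sum_le _ _).trans (Finset.sum_le_sum fun d _ => ?_)
  rw [norm_mul, norm_prod]
  refine mul_le_of_le_one_right (norm_nonneg _) ?_
  refine Finset.prod_le_one (fun i _ => norm_nonneg _) fun i _ => ?_
  rw [norm_pow]
  exact pow_le_one₀ (norm_nonneg _) ((PiLp.norm_apply_le z i).trans hz)

theorem steinerPolynomial_isHomogeneous {n k : ℕ} {S : Finset (Finset (Fin n))}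
    (hS : ∀ J ∈ S, J.card = k) (c : Finset (Fin n) → ℤ) :
    (steinerPolynomial S c).IsHomogeneous k := by
  refine MvPolynomial.IsHomogeneous.sum _ _ _ fun J hJ => ?_
  have h := (MvPolynomial.isHomogeneous_C (Fin n) (c J : ℂ)).mul
    (MvPolynomial.IsHomogeneous.prod J (fun j => (MvPolynomial.X j : MvPolynomial (Fin n) ℂ))
      (fun _ => 1) fun j _ => MvPolynomial.isHomogeneous_X ℂ j)
  simpa [hS J hJ] using h

/-!
The signs are chosen at random. Three bounds on the polynomial `p` suffice:

* on `ℓ_1^n`, for every choice of signs, `|p(z)|` is at most the elementary symmetric polynomial of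
  degree `k` in the `|z_i|`, which is `O(2^{-k})`;
* on `ℓ_2^n`, for more than half of the signs, `‖p‖ = O(k² (log n)^{3/2})`
  (`exists_bad_signs_euclidean`);
* on `ℓ_∞^n`, for more than half of the signs, `‖p‖ = O(2^{-k} n^{k/2})`
  (`exists_bad_signs_polydisc`).

Some signs thus satisfy all three (`exists_signs`), and the bounds for all other `q` follow by
interpolation between `ℓ_2` and `ℓ_1` or `ℓ_∞`. Interpolation needs no polarization: the three lines
theorem applies to the polynomial itself along the entire curve `z_i |z_i|^{e-1}`
(`norm_signedSum_le_interpolate`). For `q ≠ 2` the exponential decay in `k` at the endpoint `1` or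
`∞` beats the polynomial growth at `2`, whence a constant independent of `k`.

The two random bounds come from one chaining argument (`exists_bad_signs_chaining`). Coordinates are
rounded toward zero to multiples of `2 / 2^l`, and Hoeffding's inequality is applied to all
increments between the finite nets of consecutive levels. The Steiner property enters through the
variance of the increments: a pair `j ∈ J` is determined by `J \ {j}`, so that
`∑_J |z_J - w_J|²` is at most `k ‖z - w‖_∞²` times an elementary symmetric polynomial of degree
`k - 1`, hence `O(k ‖z - w‖_∞²)` on the Euclidean ball. The rounded points of that ball are counted
by `(4n+1)^{4^l}`, since they have integer coordinates, in the units of the grid, whose squares sum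
to at most `4^l`; each of the `O(k log n)` levels then contributes `O(√k √(log n))`. On the polydisc
the entropy is `O(n l)` and the sum over the levels converges.
-/

/-! ### Random signs -/

/-- The moment generating function of a Rademacher sum is dominated by that of a Gaussian. -/
theorem sum_exp_signs_le {ι : Type*} [Fintype ι] [DecidableEq ι] (a : ι → ℝ) :
    ∑ c : ι → ℤˣ, Real.exp (∑ J, ((c J : ℤ) : ℝ) * a J) ≤
      Fintype.card (ι → ℤˣ) * Real.exp ((∑ J, a J ^ 2) / 2) := by
  have h1 : ∑ c : ι → ℤˣ, Real.exp (∑ J, ((c J : ℤ) : ℝ) * a J) =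
      ∏ J, ∑ u : ℤˣ, Real.exp (((u : ℤ) : ℝ) * a J) := by
    rw [Finset.prod_univ_sum, Fintype.piFinset_univ]
    exact Finset.sum_congr rfl fun c _ => Real.exp_sum _ _
  have h2 : (Fintype.card (ι → ℤˣ) : ℝ) * Real.exp ((∑ J, a J ^ 2) / 2) =
      ∏ J, (2 * Real.exp (a J ^ 2 / 2)) := by
    rw [Finset.prod_mul_distrib, ← Real.exp_sum, ← Finset.sum_div]
    simp
  rw [h1, h2]
  refine Finset.prod_le_prod (fun J _ => Finset.sum_nonneg fun u _ => (Real.exp_pos _).le)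
    fun J _ => ?_
  have h3 := Real.cosh_le_exp_half_sq (a J)
  rw [Real.cosh_eq] at h3
  have h4 : ∑ u : ℤˣ, Real.exp (((u : ℤ) : ℝ) * a J) = Real.exp (a J) + Real.exp (-a J) := by
    rw [UnitsInt.univ, Finset.sum_pair (by decide)]
    simp
  rw [h4]
  linarith

/-- Hoeffding's inequality for uniformly random signs, in counting form. -/
theorem card_signs_real_le {ι : Type*} [Fintype ι] [DecidableEq ι] (a : ι → ℝ) {s σ : ℝ}
    (hs : 0 ≤ s) (hσ : 0 < σ) (ha : ∑ J, a J ^ 2 ≤ σ ^ 2) :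
    ((Finset.univ.filter fun c : ι → ℤˣ => s * σ < ∑ J, ((c J : ℤ) : ℝ) * a J).card : ℝ) ≤
      Fintype.card (ι → ℤˣ) * Real.exp (-(s ^ 2 / 2)) := by
  set F := Finset.univ.filter fun c : ι → ℤˣ => s * σ < ∑ J, ((c J : ℤ) : ℝ) * a J with hF
  -- The exponent `s / σ` is the optimal one in the exponential Markov inequality.
  have h1 := sum_exp_signs_le fun J => s / σ * a J
  have h2 : (F.card : ℝ) * Real.exp (s ^ 2) ≤
      ∑ c : ι → ℤˣ, Real.exp (∑ J, ((c J : ℤ) : ℝ) * (s / σ * a J)) := by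
    rw [← nsmul_eq_mul, ← Finset.sum_const]
    refine (Finset.sum_le_sum fun c hc => ?_).trans
      (Finset.sum_le_sum_of_subset_of_nonneg (Finset.subset_univ F)
        fun c _ _ => (Real.exp_pos _).le)
    rw [Real.exp_le_exp]
    have h3 : s * σ < ∑ J, ((c J : ℤ) : ℝ) * a J := (Finset.mem_filter.1 hc).2
    calc s ^ 2 = s / σ * (s * σ) := by field_simp
      _ ≤ s / σ * ∑ J, ((c J : ℤ) : ℝ) * a J := by gcongr
      _ = ∑ J, ((c J : ℤ) : ℝ) * (s / σ * a J) := by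
        rw [Finset.mul_sum]; exact Finset.sum_congr rfl fun _ _ => by ring
  have h4 : (∑ J, (s / σ * a J) ^ 2) / 2 ≤ s ^ 2 / 2 := by
    have : ∑ J, (s / σ * a J) ^ 2 = (s / σ) ^ 2 * ∑ J, a J ^ 2 := by
      rw [Finset.mul_sum]; exact Finset.sum_congr rfl fun _ _ => by ring
    rw [this]
    have : (s / σ) ^ 2 * ∑ J, a J ^ 2 ≤ (s / σ) ^ 2 * σ ^ 2 := by gcongr
    have h5 : (s / σ) ^ 2 * σ ^ 2 = s ^ 2 := by field_simp
    linarith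
  have h6 : (F.card : ℝ) * Real.exp (s ^ 2) ≤
      Fintype.card (ι → ℤˣ) * Real.exp (s ^ 2 / 2) :=
    (h2.trans h1).trans (by gcongr)
  have h7 : Real.exp (s ^ 2 / 2) = Real.exp (-(s ^ 2 / 2)) * Real.exp (s ^ 2) := by
    rw [← Real.exp_add]; ring_nf
  rw [h7, ← mul_assoc] at h6
  exact le_of_mul_le_mul_right h6 (Real.exp_pos _)

/-- Hoeffding's inequality for complex coefficients: if the modulus exceeds `2 s σ`, then one of
`± re`, `± im` exceeds `s σ`. -/
theorem card_signs_complex_le {ι : Type*} [Fintype ι] [DecidableEq ι] (a : ι → ℂ) {s σ : ℝ}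
    (hs : 0 ≤ s) (hσ : 0 < σ) (ha : ∑ J, ‖a J‖ ^ 2 ≤ σ ^ 2) :
    ((Finset.univ.filter fun c : ι → ℤˣ =>
        2 * s * σ < ‖∑ J, ((c J : ℤ) : ℂ) * a J‖).card : ℝ) ≤
      Fintype.card (ι → ℤˣ) * (4 * Real.exp (-(s ^ 2 / 2))) := by
  set G : (ι → ℝ) → Finset (ι → ℤˣ) := fun b =>
    Finset.univ.filter fun c : ι → ℤˣ => s * σ < ∑ J, ((c J : ℤ) : ℝ) * b J with hG
  have hre : ∑ J, (a J).re ^ 2 ≤ σ ^ 2 :=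
    (Finset.sum_le_sum fun J _ => sq_le_sq' (by linarith [(abs_le.1 (Complex.abs_re_le_norm (a J))).1])
      ((abs_le.1 (Complex.abs_re_le_norm (a J))).2)).trans ha
  have him : ∑ J, (a J).im ^ 2 ≤ σ ^ 2 :=
    (Finset.sum_le_sum fun J _ => sq_le_sq' (by linarith [(abs_le.1 (Complex.abs_im_le_norm (a J))).1])
      ((abs_le.1 (Complex.abs_im_le_norm (a J))).2)).trans ha
  have b1 := card_signs_real_le (fun J => (a J).re) hs hσ hre
  have b2 := card_signs_real_le (fun J => -(a J).re) hs hσ (by simpa using hre)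
  have b3 := card_signs_real_le (fun J => (a J).im) hs hσ him
  have b4 := card_signs_real_le (fun J => -(a J).im) hs hσ (by simpa using him)
  have hsub : (Finset.univ.filter fun c : ι → ℤˣ =>
        2 * s * σ < ‖∑ J, ((c J : ℤ) : ℂ) * a J‖) ⊆
      (G (fun J => (a J).re) ∪ G (fun J => -(a J).re)) ∪
        (G (fun J => (a J).im) ∪ G (fun J => -(a J).im)) := by
    intro c hc
    have hc' : 2 * s * σ < ‖∑ J, ((c J : ℤ) : ℂ) * a J‖ := (Finset.mem_filter.1 hc).2
    have hle := Complex.norm_le_abs_re_add_abs_im (∑ J, ((c J : ℤ) : ℂ) * a J)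
    have e1 : (∑ J, ((c J : ℤ) : ℂ) * a J).re = ∑ J, ((c J : ℤ) : ℝ) * (a J).re := by
      simp [Complex.re_sum]
    have e2 : (∑ J, ((c J : ℤ) : ℂ) * a J).im = ∑ J, ((c J : ℤ) : ℝ) * (a J).im := by
      simp [Complex.im_sum]
    rw [e1, e2] at hle
    simp only [hG, Finset.mem_union, Finset.mem_filter, Finset.mem_univ, true_and, mul_neg,
      Finset.sum_neg_distrib]
    by_contra! hcon
    have h1 := abs_le.2 ⟨by linarith [hcon.1.2], hcon.1.1⟩
    have h2 := abs_le.2 ⟨by linarith [hcon.2.2], hcon.2.1⟩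
    linarith
  have hcard := (Finset.card_le_card hsub).trans ((Finset.card_union_le _ _).trans
    (add_le_add (Finset.card_union_le _ _) (Finset.card_union_le _ _)))
  have hcard' : ((Finset.univ.filter fun c : ι → ℤˣ =>
        2 * s * σ < ‖∑ J, ((c J : ℤ) : ℂ) * a J‖).card : ℝ) ≤
      (((G (fun J => (a J).re)).card : ℝ) + (G (fun J => -(a J).re)).card) +
        ((G (fun J => (a J).im)).card + (G (fun J => -(a J).im)).card) := by exact_mod_cast hcard
  simp only [hG] at hcard'
  linarith

/-! ### Rounding to dyadic grids -/

theorem exists_int_round_toward_zero (x : ℝ) : ∃ m : ℤ, |(m : ℝ)| ≤ |x| ∧ |x - m| ≤ 1 := by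
  rcases le_total 0 x with h | h
  · refine ⟨⌊x⌋, ?_, ?_⟩
    · rw [abs_of_nonneg h, abs_of_nonneg (by exact_mod_cast Int.floor_nonneg.2 h)]
      exact Int.floor_le x
    · rw [abs_le]
      constructor <;> linarith [Int.floor_le x, Int.lt_floor_add_one x]
  · refine ⟨⌈x⌉, ?_, ?_⟩
    · rw [abs_of_nonpos h, abs_of_nonpos (by exact_mod_cast Int.ceil_le.2 (by simpa using h))]
      linarith [Int.le_ceil x]
    · rw [abs_le]
      constructor <;> linarith [Int.le_ceil x, Int.ceil_lt_add_one x]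

/-- An integer at distance at most `1` from `x` and not larger than `x` in absolute value. -/
noncomputable def roundTowardZero (x : ℝ) : ℤ := (exists_int_round_toward_zero x).choose

theorem abs_roundTowardZero_le (x : ℝ) : |(roundTowardZero x : ℝ)| ≤ |x| :=
  (exists_int_round_toward_zero x).choose_spec.1

theorem abs_sub_roundTowardZero_le (x : ℝ) : |x - roundTowardZero x| ≤ 1 :=
  (exists_int_round_toward_zero x).choose_spec.2

/-- The real and imaginary parts of the coordinates of `z`, in units of `2 / 2 ^ l` and rounded
toward zero. The unit is `2` at level `0`, so that points of the polydisc are rounded to `0`. -/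
noncomputable def gridIndex {n : ℕ} (l : ℕ) (z : Fin n → ℂ) : Fin n ⊕ Fin n → ℤ :=
  Sum.elim (fun i => roundTowardZero (2 ^ l / 2 * (z i).re))
    (fun i => roundTowardZero (2 ^ l / 2 * (z i).im))

/-- The point of `ℂⁿ` whose real and imaginary parts are the multiples `m` of `2 / 2 ^ l`. -/
noncomputable def gridPoint {n : ℕ} (l : ℕ) (m : Fin n ⊕ Fin n → ℤ) : Fin n → ℂ :=
  fun i => ⟨2 / 2 ^ l * m (Sum.inl i), 2 / 2 ^ l * m (Sum.inr i)⟩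

/-- `z` with the real and imaginary parts of its coordinates rounded toward zero to multiples of
`2 / 2 ^ l`. -/
noncomputable def gridRound {n : ℕ} (l : ℕ) (z : Fin n → ℂ) : Fin n → ℂ :=
  gridPoint l (gridIndex l z)

theorem abs_scaled_round_le (l : ℕ) (x : ℝ) :
    |2 / 2 ^ l * (roundTowardZero (2 ^ l / 2 * x) : ℝ)| ≤ |x| := by
  rw [abs_mul, abs_of_pos (by positivity : (0 : ℝ) < 2 / 2 ^ l)]
  calc 2 / 2 ^ l * |(roundTowardZero (2 ^ l / 2 * x) : ℝ)| ≤ 2 / 2 ^ l * |2 ^ l / 2 * x| :=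
        mul_le_mul_of_nonneg_left (abs_roundTowardZero_le _) (by positivity)
    _ = |x| := by
        rw [abs_mul, abs_of_pos (by positivity : (0 : ℝ) < 2 ^ l / 2)]
        field_simp

theorem abs_sub_scaled_round_le (l : ℕ) (x : ℝ) :
    |x - 2 / 2 ^ l * (roundTowardZero (2 ^ l / 2 * x) : ℝ)| ≤ 2 * (1 / 2) ^ l := by
  have h : x - 2 / 2 ^ l * (roundTowardZero (2 ^ l / 2 * x) : ℝ) =
      2 / 2 ^ l * (2 ^ l / 2 * x - roundTowardZero (2 ^ l / 2 * x)) := by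
    field_simp
  rw [h, abs_mul, abs_of_pos (by positivity : (0 : ℝ) < 2 / 2 ^ l)]
  calc 2 / 2 ^ l * |2 ^ l / 2 * x - (roundTowardZero (2 ^ l / 2 * x) : ℝ)| ≤ 2 / 2 ^ l * 1 := by
        gcongr; exact abs_sub_roundTowardZero_le _
    _ = 2 * (1 / 2) ^ l := by rw [one_div, inv_pow]; ring

theorem norm_gridRound_apply_le {n : ℕ} (l : ℕ) (z : Fin n → ℂ) (i : Fin n) :
    ‖gridRound l z i‖ ≤ ‖z i‖ := by
  rw [← sq_le_sq₀ (norm_nonneg _) (norm_nonneg _), Complex.sq_norm, Complex.sq_norm,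
    Complex.normSq_apply, Complex.normSq_apply]
  have h1 := sq_le_sq.2 (abs_scaled_round_le l (z i).re)
  have h2 := sq_le_sq.2 (abs_scaled_round_le l (z i).im)
  simp only [gridRound, gridPoint, gridIndex, Sum.elim_inl, Sum.elim_inr]
  nlinarith

theorem norm_sub_gridRound_apply_le {n : ℕ} (l : ℕ) (z : Fin n → ℂ) (i : Fin n) :
    ‖z i - gridRound l z i‖ ≤ 4 * (1 / 2) ^ l := by
  refine (Complex.norm_le_abs_re_add_abs_im _).trans ?_
  have h1 := abs_sub_scaled_round_le l (z i).re
  have h2 := abs_sub_scaled_round_le l (z i).im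
  simp only [gridRound, gridPoint, gridIndex, Sum.elim_inl, Sum.elim_inr, Complex.sub_re,
    Complex.sub_im]
  linarith

theorem norm_gridRound_succ_sub_le {n : ℕ} (l : ℕ) (z : Fin n → ℂ) (i : Fin n) :
    ‖gridRound (l + 1) z i - gridRound l z i‖ ≤ 6 * (1 / 2) ^ l := by
  have h1 := norm_sub_gridRound_apply_le l z i
  have h2 := norm_sub_gridRound_apply_le (l + 1) z i
  have h3 := norm_sub_le (z i - gridRound l z i) (z i - gridRound (l + 1) z i)
  rw [sub_sub_sub_cancel_left] at h3
  rw [pow_succ] at h2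
  linarith

theorem gridRound_zero {n : ℕ} {z : Fin n → ℂ} (hz : ∀ i, ‖z i‖ ≤ 1) : gridRound 0 z = 0 := by
  have key : ∀ x : ℝ, |x| ≤ 1 → roundTowardZero (2 ^ 0 / 2 * x) = 0 := by
    intro x hx
    have h := abs_roundTowardZero_le (2 ^ 0 / 2 * x)
    rw [abs_mul] at h
    have h1 : |(roundTowardZero (2 ^ 0 / 2 * x) : ℝ)| < 1 := by
      refine h.trans_lt ?_
      norm_num
      linarith
    exact Int.abs_lt_one_iff.1 (by exact_mod_cast h1)
  funext i
  have h1 := key _ ((Complex.abs_re_le_norm (z i)).trans (hz i))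
  have h2 := key _ ((Complex.abs_im_le_norm (z i)).trans (hz i))
  simp only [gridRound, gridPoint, gridIndex, Sum.elim_inl, Sum.elim_inr, h1, h2]
  simp [Complex.ext_iff]

/-! ### Chaining -/

/-- The sum `∑_{J ∈ S} c_J z_J`, the value at `z` of `steinerPolynomial S c`. -/
noncomputable def signedSum {n : ℕ} (S : Finset (Finset (Fin n))) (c : Finset (Fin n) → ℤˣ)
    (z : Fin n → ℂ) : ℂ := ∑ J ∈ S, ((c J : ℤ) : ℂ) * ∏ j ∈ J, z j

theorem signedSum_zero {n : ℕ} {S : Finset (Finset (Fin n))} (hS : ∀ J ∈ S, J.Nonempty)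
    (c : Finset (Fin n) → ℤˣ) : signedSum S c 0 = 0 := by
  refine Finset.sum_eq_zero fun J hJ => ?_
  obtain ⟨j, hj⟩ := hS J hJ
  rw [Finset.prod_eq_zero hj rfl, mul_zero]

theorem norm_intUnits_mul (u : ℤˣ) (x : ℂ) : ‖((u : ℤ) : ℂ) * x‖ = ‖x‖ := by
  rcases Int.units_eq_one_or u with h | h <;> simp [h]

/-- Whatever the signs, an increment is at most the number of terms times a bound on each of them.
-/
theorem norm_signedSum_sub_le {n : ℕ} (S : Finset (Finset (Fin n))) (c : Finset (Fin n) → ℤˣ)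
    {z w : Fin n → ℂ} {r : ℝ} (hr : 0 ≤ r)
    (h : ∑ J ∈ S, ‖∏ j ∈ J, z j - ∏ j ∈ J, w j‖ ^ 2 ≤ r ^ 2) :
    ‖signedSum S c z - signedSum S c w‖ ≤ S.card * r := by
  rw [signedSum, signedSum, ← Finset.sum_sub_distrib, ← nsmul_eq_mul, ← Finset.sum_const]
  refine norm_sum_le_of_le _ fun J hJ => ?_
  rw [← mul_sub, norm_intUnits_mul, ← sq_le_sq₀ (norm_nonneg _) hr]
  exact (Finset.single_le_sum (f := fun J => ‖∏ j ∈ J, z j - ∏ j ∈ J, w j‖ ^ 2)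
    (fun _ _ => by positivity) hJ).trans h

theorem card_signedSum_sub_le {n : ℕ} (S : Finset (Finset (Fin n))) (z w : Fin n → ℂ) {s σ : ℝ}
    (hs : 0 ≤ s) (hσ : 0 < σ)
    (h : ∑ J ∈ S, ‖∏ j ∈ J, z j - ∏ j ∈ J, w j‖ ^ 2 ≤ σ ^ 2) :
    ((Finset.univ.filter fun c : Finset (Fin n) → ℤˣ =>
        2 * s * σ < ‖signedSum S c z - signedSum S c w‖).card : ℝ) ≤
      Fintype.card (Finset (Fin n) → ℤˣ) * (4 * Real.exp (-(s ^ 2 / 2))) := by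
  have key := card_signs_complex_le
    (fun J => if J ∈ S then ∏ j ∈ J, z j - ∏ j ∈ J, w j else 0) (s := s) (σ := σ) hs hσ (by
      refine le_trans (le_of_eq ?_) h
      rw [← Finset.sum_subset (Finset.subset_univ S)]
      · exact Finset.sum_congr rfl fun J hJ => by rw [if_pos hJ]
      · intro J _ hJ
        simp [hJ])
  convert key using 6 with c
  rw [signedSum, signedSum, ← Finset.sum_sub_distrib, ← Finset.sum_subset (Finset.subset_univ S)]
  · exact Finset.sum_congr rfl fun J hJ => by rw [if_pos hJ, mul_sub]
  · intro J _ hJ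
    simp [hJ]

theorem sum_exp_neg_le (K : ℕ) :
    ∑ l ∈ Finset.range K, 4 * Real.exp (-((l : ℝ) + 4)) < 1 / 2 := by
  have he : Real.exp (-1) ≤ 1 / 2 := by
    rw [Real.exp_neg, one_div]
    exact inv_anti₀ (by norm_num) (by linarith [Real.add_one_le_exp (1 : ℝ)])
  have h1 : ∀ l : ℕ, Real.exp (-((l : ℝ) + 4)) ≤ (1 / 2) ^ l * (1 / 16) := by
    intro l
    have : Real.exp (-((l : ℝ) + 4)) = Real.exp (-1) ^ (l + 4) := by
      rw [← Real.exp_nat_mul]; push_cast; ring_nf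
    rw [this]
    calc Real.exp (-1) ^ (l + 4) ≤ (1 / 2) ^ (l + 4) :=
          pow_le_pow_left₀ (Real.exp_pos _).le he _
      _ = (1 / 2) ^ l * (1 / 16) := by rw [pow_add]; norm_num
  have h2 : ∑ l ∈ Finset.range K, 4 * Real.exp (-((l : ℝ) + 4)) ≤
      (∑ l ∈ Finset.range K, (1 / 2 : ℝ) ^ l) * (1 / 4) := by
    rw [Finset.sum_mul]
    exact Finset.sum_le_sum fun l _ => by linarith [h1 l]
  rw [geom_sum_eq (by norm_num)] at h2
  have h3 : (0 : ℝ) < (1 / 2) ^ K := by positivity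
  have h4 : ((1 / 2 : ℝ) ^ K - 1) / (1 / 2 - 1) * (1 / 4) = (1 - (1 / 2) ^ K) / 2 := by ring
  rw [h4] at h2
  linarith

/-- The deviation, in units of the standard deviation, allowed to the real and imaginary parts of
the increments between the levels `l` and `l + 1`, when `exp (h l)` bounds the size of the net of level `l`. -/
noncomputable def deviation (h : ℕ → ℝ) (l : ℕ) : ℝ := √(2 * (h (l + 1) + h l + (l + 4)))

/-- The chaining bound. Along the roundings of `z` to finer and finer grids, the value at `z` is the
sum of the increments between consecutive levels and of the error at the last level `K`. By
hypothesis the variance of an increment is at most `D ^ 2` times the squared sup-distance, and fewer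
than half of the signs violate Hoeffding's bound for some increment between two nets. -/
theorem exists_bad_signs_chaining {n : ℕ} {S : Finset (Finset (Fin n))}
    (hS : ∀ J ∈ S, J.Nonempty) {B : Set (Fin n → ℂ)} {D : ℝ} (hD : 0 < D)
    (hsolid : ∀ z ∈ B, ∀ w : Fin n → ℂ, (∀ i, ‖w i‖ ≤ ‖z i‖) → w ∈ B)
    (hB : ∀ z ∈ B, ∀ i, ‖z i‖ ≤ 1)
    (hvar : ∀ z ∈ B, ∀ w ∈ B, ∀ ε : ℝ, 0 ≤ ε → (∀ i, ‖z i - w i‖ ≤ ε) →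
      ∑ J ∈ S, ‖∏ j ∈ J, z j - ∏ j ∈ J, w j‖ ^ 2 ≤ (D * ε) ^ 2)
    {h : ℕ → ℝ} (hh : ∀ l, 0 ≤ h l) {T : ℕ → Finset (Fin n ⊕ Fin n → ℤ)}
    (hT : ∀ l, ((T l).card : ℝ) ≤ Real.exp (h l)) (hTmem : ∀ l, ∀ z ∈ B, gridIndex l z ∈ T l)
    (K : ℕ) :
    ∃ bad : Finset (Finset (Fin n) → ℤˣ),
      2 * bad.card < Fintype.card (Finset (Fin n) → ℤˣ) ∧
      ∀ c ∉ bad, ∀ z ∈ B, ‖signedSum S c z‖ ≤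
        ∑ l ∈ Finset.range K, 2 * deviation h l * (D * (6 * (1 / 2) ^ l)) +
          S.card * (D * (4 * (1 / 2) ^ K)) := by
  classical
  -- The pairs of net points that can be consecutive roundings of a point of `B`, and the signs
  -- that are bad for such a pair.
  set P : ℕ → Finset ((Fin n ⊕ Fin n → ℤ) × (Fin n ⊕ Fin n → ℤ)) := fun l =>
    (T (l + 1) ×ˢ T l).filter fun x =>
      gridPoint (l + 1) x.1 ∈ B ∧ gridPoint l x.2 ∈ B ∧
        ∀ i, ‖gridPoint (l + 1) x.1 i - gridPoint l x.2 i‖ ≤ 6 * (1 / 2) ^ l with hP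
  set F : ℕ → ((Fin n ⊕ Fin n → ℤ) × (Fin n ⊕ Fin n → ℤ)) → Finset (Finset (Fin n) → ℤˣ) :=
    fun l x => Finset.univ.filter fun c =>
      2 * deviation h l * (D * (6 * (1 / 2) ^ l)) <
        ‖signedSum S c (gridPoint (l + 1) x.1) - signedSum S c (gridPoint l x.2)‖ with hF
  have hround : ∀ z ∈ B, ∀ l, gridRound l z ∈ B := fun z hz l =>
    hsolid z hz _ (norm_gridRound_apply_le l z)
  refine ⟨(Finset.range K).biUnion fun l => (P l).biUnion (F l), ?_, ?_⟩
  · set N : ℝ := ((Fintype.card (Finset (Fin n) → ℤˣ) : ℕ) : ℝ) with hN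
    have hNpos : 0 < N := by rw [hN]; exact_mod_cast Fintype.card_pos
    have hFcard : ∀ l, ∀ x ∈ P l, ((F l x).card : ℝ) ≤
        N * (4 * Real.exp (-(h (l + 1) + h l + (l + 4)))) := by
      intro l x hx
      obtain ⟨-, h1, h2, h3⟩ := Finset.mem_filter.1 hx
      have := card_signedSum_sub_le S (gridPoint (l + 1) x.1) (gridPoint l x.2)
        (s := deviation h l) (σ := D * (6 * (1 / 2) ^ l)) (Real.sqrt_nonneg _) (by positivity)
        (hvar _ h1 _ h2 _ (by positivity) h3)
      rwa [deviation, Real.sq_sqrt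
        (by have := hh l; have := hh (l + 1); positivity), mul_div_cancel_left₀ _ two_ne_zero]
        at this
    have hPcard : ∀ l, ((P l).card : ℝ) ≤ Real.exp (h (l + 1) + h l) := by
      intro l
      rw [Real.exp_add]
      refine le_trans ?_ (mul_le_mul (hT (l + 1)) (hT l) (by positivity) (Real.exp_pos _).le)
      rw [← Nat.cast_mul, ← Finset.card_product]
      exact_mod_cast Finset.card_filter_le _ _
    have hlevel : ∀ l, (((P l).biUnion (F l)).card : ℝ) ≤
        N * (4 * Real.exp (-((l : ℝ) + 4))) := by
      intro l
      calc (((P l).biUnion (F l)).card : ℝ) ≤ ∑ x ∈ P l, ((F l x).card : ℝ) := by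
            exact_mod_cast Finset.card_biUnion_le
        _ ≤ ∑ x ∈ P l, N * (4 * Real.exp (-(h (l + 1) + h l + (l + 4)))) :=
            Finset.sum_le_sum (hFcard l)
        _ = (P l).card * (N * (4 * Real.exp (-(h (l + 1) + h l + (l + 4))))) := by
            rw [Finset.sum_const, nsmul_eq_mul]
        _ ≤ Real.exp (h (l + 1) + h l) * (N * (4 * Real.exp (-(h (l + 1) + h l + (l + 4))))) := by
            gcongr
            exact hPcard l
        _ = N * (4 * Real.exp (-((l : ℝ) + 4))) := by
            rw [neg_add (h (l + 1) + h l), Real.exp_add (-(h (l + 1) + h l)),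
              Real.exp_neg (h (l + 1) + h l)]
            field_simp
    have htotal : ((((Finset.range K).biUnion fun l => (P l).biUnion (F l)).card : ℕ) : ℝ) ≤
        N * ∑ l ∈ Finset.range K, 4 * Real.exp (-((l : ℝ) + 4)) := by
      calc _ ≤ ∑ l ∈ Finset.range K, (((P l).biUnion (F l)).card : ℝ) := by
            exact_mod_cast Finset.card_biUnion_le
        _ ≤ _ := by
            rw [Finset.mul_sum]
            exact Finset.sum_le_sum fun l _ => hlevel l
    have hlt := mul_lt_mul_of_pos_left (sum_exp_neg_le K) hNpos
    have : (2 : ℝ) * ((((Finset.range K).biUnion fun l => (P l).biUnion (F l)).card : ℕ) : ℝ) < N :=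
      by linarith
    rw [hN] at this
    exact_mod_cast this
  · intro c hc z hz
    have hstep : ∀ l ∈ Finset.range K,
        ‖signedSum S c (gridRound (l + 1) z) - signedSum S c (gridRound l z)‖ ≤
          2 * deviation h l * (D * (6 * (1 / 2) ^ l)) := by
      intro l hl
      by_contra! hcon
      refine hc (Finset.mem_biUnion.2 ⟨l, hl, Finset.mem_biUnion.2
        ⟨(gridIndex (l + 1) z, gridIndex l z), ?_, ?_⟩⟩)
      · exact Finset.mem_filter.2 ⟨Finset.mem_product.2 ⟨hTmem _ z hz, hTmem _ z hz⟩,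
          hround z hz _, hround z hz _, norm_gridRound_succ_sub_le l z⟩
      · exact Finset.mem_filter.2 ⟨Finset.mem_univ _, hcon⟩
    have htail : ‖signedSum S c z - signedSum S c (gridRound K z)‖ ≤
        S.card * (D * (4 * (1 / 2) ^ K)) :=
      norm_signedSum_sub_le S c (by positivity)
        (hvar _ hz _ (hround z hz K) _ (by positivity) (norm_sub_gridRound_apply_le K z))
    have htele : signedSum S c (gridRound K z) = ∑ l ∈ Finset.range K,
        (signedSum S c (gridRound (l + 1) z) - signedSum S c (gridRound l z)) := by
      rw [Finset.sum_range_sub (fun l => signedSum S c (gridRound l z)),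
        gridRound_zero (hB z hz), signedSum_zero hS, sub_zero]
    have hmain : ‖signedSum S c (gridRound K z)‖ ≤
        ∑ l ∈ Finset.range K, 2 * deviation h l * (D * (6 * (1 / 2) ^ l)) := by
      rw [htele]
      exact norm_sum_le_of_le _ hstep
    have := norm_add_le (signedSum S c (gridRound K z))
      (signedSum S c z - signedSum S c (gridRound K z))
    rw [add_sub_cancel] at this
    linarith

/-! ### Variance of the increments -/

theorem norm_prod_sub_prod_le {ι : Type*} [DecidableEq ι] (J : Finset ι) {z w : ι → ℂ}
    {a : ι → ℝ} {ε : ℝ} (hz : ∀ i, ‖z i‖ ≤ a i) (hw : ∀ i, ‖w i‖ ≤ a i)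
    (h : ∀ i, ‖z i - w i‖ ≤ ε) :
    ‖∏ j ∈ J, z j - ∏ j ∈ J, w j‖ ≤ ε * ∑ j ∈ J, ∏ i ∈ J.erase j, a i := by
  have ha : ∀ i, 0 ≤ a i := fun i => (norm_nonneg _).trans (hz i)
  induction J using Finset.induction_on with
  | empty => simp
  | insert i J hi ih =>
    have hsum : ∑ j ∈ J, ∏ x ∈ (insert i J).erase j, a x =
        a i * ∑ j ∈ J, ∏ x ∈ J.erase j, a x := by
      rw [Finset.mul_sum]
      refine Finset.sum_congr rfl fun j hj => ?_
      have hij : i ≠ j := fun h => hi (h ▸ hj)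
      rw [Finset.erase_insert_of_ne hij,
        Finset.prod_insert fun h => hi (Finset.mem_of_mem_erase h)]
    rw [Finset.prod_insert hi, Finset.prod_insert hi, Finset.sum_insert hi,
      Finset.erase_insert hi, hsum]
    have hsplit : z i * ∏ j ∈ J, z j - w i * ∏ j ∈ J, w j =
        (z i - w i) * ∏ j ∈ J, z j + w i * (∏ j ∈ J, z j - ∏ j ∈ J, w j) := by ring
    have hprod : ‖∏ j ∈ J, z j‖ ≤ ∏ j ∈ J, a j := by
      rw [norm_prod]
      exact Finset.prod_le_prod (fun _ _ => norm_nonneg _) fun j _ => hz j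
    calc ‖z i * ∏ j ∈ J, z j - w i * ∏ j ∈ J, w j‖
        ≤ ‖z i - w i‖ * ‖∏ j ∈ J, z j‖ + ‖w i‖ * ‖∏ j ∈ J, z j - ∏ j ∈ J, w j‖ := by
          rw [hsplit, ← norm_mul, ← norm_mul]
          exact norm_add_le _ _
      _ ≤ ε * ∏ j ∈ J, a j + a i * (ε * ∑ j ∈ J, ∏ x ∈ J.erase j, a x) :=
          add_le_add
            (mul_le_mul (h i) hprod (norm_nonneg _) ((norm_nonneg _).trans (h i)))
            (mul_le_mul (hw i) ih (norm_nonneg _) (ha i))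
      _ = ε * (∏ j ∈ J, a j + a i * ∑ j ∈ J, ∏ x ∈ J.erase j, a x) := by ring

/-- In an `S_p(k-1, k, n)` partial Steiner system the pairs `j ∈ J` are determined by the
`(k-1)`-element sets `J \ {j}`, so that sums over such pairs are bounded by sums over all
`(k-1)`-element sets. -/
theorem IsPartialSteinerSystem.sum_erase_le {k n : ℕ} {S : Finset (Finset (Fin n))}
    (hS : IsPartialSteinerSystem (k - 1) k n S) {g : Finset (Fin n) → ℝ} (hg : ∀ I, 0 ≤ g I) :
    ∑ J ∈ S, ∑ j ∈ J, g (J.erase j) ≤ ∑ I ∈ Finset.powersetCard (k - 1) Finset.univ, g I := by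
  rw [Finset.sum_sigma']
  have hinj : Set.InjOn (fun x : (_ : Finset (Fin n)) × Fin n => x.1.erase x.2)
      (S.sigma fun J => J) := by
    rintro ⟨J, j⟩ hJ ⟨J', j'⟩ hJ' heq
    simp only [Finset.coe_sigma, Set.mem_sigma_iff, Finset.mem_coe] at hJ hJ' heq
    have hJJ : J = J' := by
      refine hS.2 (J.erase j) ?_ J hJ.1 J' hJ'.1 (Finset.erase_subset _ _)
        (heq ▸ Finset.erase_subset _ _)
      rw [Finset.card_erase_of_mem hJ.2, hS.1 J hJ.1]
    subst hJJ
    have hjj : j = j' := by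
      by_contra hne
      have h1 : j ∈ J.erase j' := Finset.mem_erase.2 ⟨hne, hJ.2⟩
      rw [← heq] at h1
      exact Finset.notMem_erase _ _ h1
    rw [hjj]
  rw [← Finset.sum_image (f := g) hinj]
  refine Finset.sum_le_sum_of_subset_of_nonneg ?_ fun I _ _ => hg I
  intro I hI
  obtain ⟨⟨J, j⟩, hJ, rfl⟩ := Finset.mem_image.1 hI
  obtain ⟨hJ1, hJ2⟩ := Finset.mem_sigma.1 hJ
  refine Finset.mem_powersetCard.2 ⟨Finset.subset_univ _, ?_⟩
  rw [Finset.card_erase_of_mem hJ2, hS.1 J hJ1]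

/-- The variance of an increment is controlled by the sup-distance, with a constant that depends only
on the elementary symmetric polynomial of degree `k - 1` in the `a_i ^ 2`. -/
theorem IsPartialSteinerSystem.sum_norm_prod_sub_prod_sq_le {k n : ℕ}
    {S : Finset (Finset (Fin n))} (hS : IsPartialSteinerSystem (k - 1) k n S) {z w : Fin n → ℂ}
    {a : Fin n → ℝ} {ε : ℝ} (hz : ∀ i, ‖z i‖ ≤ a i) (hw : ∀ i, ‖w i‖ ≤ a i)
    (h : ∀ i, ‖z i - w i‖ ≤ ε) :
    ∑ J ∈ S, ‖∏ j ∈ J, z j - ∏ j ∈ J, w j‖ ^ 2 ≤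
      k * (∑ I ∈ Finset.powersetCard (k - 1) Finset.univ, ∏ i ∈ I, a i ^ 2) * ε ^ 2 := by
  have hJ : ∀ J ∈ S, ‖∏ j ∈ J, z j - ∏ j ∈ J, w j‖ ^ 2 ≤
      ε ^ 2 * (k * ∑ j ∈ J, ∏ i ∈ J.erase j, a i ^ 2) := by
    intro J hJ
    refine (pow_le_pow_left₀ (norm_nonneg _) (norm_prod_sub_prod_le J hz hw h) 2).trans ?_
    rw [mul_pow]
    refine mul_le_mul_of_nonneg_left ?_ (sq_nonneg ε)
    refine sq_sum_le_card_mul_sum_sq.trans ?_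
    rw [hS.1 J hJ]
    simp only [Finset.prod_pow]
    exact le_rfl
  refine (Finset.sum_le_sum hJ).trans ?_
  rw [← Finset.mul_sum, ← Finset.mul_sum, mul_comm]
  refine mul_le_mul_of_nonneg_right ?_ (sq_nonneg ε)
  refine mul_le_mul_of_nonneg_left ?_ (Nat.cast_nonneg k)
  exact hS.sum_erase_le (g := fun I => ∏ i ∈ I, a i ^ 2)
    fun I => Finset.prod_nonneg fun i _ => sq_nonneg _

/-- A bound on elementary symmetric polynomials: the terms on the left are among those of the
expansion of `∏ (1 + t x_i) ≤ exp (t ∑ x_i)`. -/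
theorem pow_mul_sum_powersetCard_prod_le_exp {ι : Type*} [Fintype ι] (m : ℕ) {t : ℝ}
    (ht : 0 ≤ t) {x : ι → ℝ} (hx : ∀ i, 0 ≤ x i) :
    t ^ m * ∑ I ∈ Finset.powersetCard m Finset.univ, ∏ i ∈ I, x i ≤ Real.exp (t * ∑ i, x i) := by
  have hnn : ∀ i, 0 ≤ t * x i := fun i => mul_nonneg ht (hx i)
  rw [Finset.mul_sum, Finset.mul_sum]
  refine le_trans ?_ (Real.prod_one_add_le_exp_sum Finset.univ hnn)
  rw [Finset.prod_one_add]
  refine le_trans (le_of_eq ?_) (Finset.sum_le_sum_of_subset_of_nonneg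
    (s := Finset.powersetCard m Finset.univ)
    (fun I hI => Finset.mem_powerset.2 (Finset.mem_powersetCard.1 hI).1)
    fun I _ _ => Finset.prod_nonneg fun i _ => hnn i)
  refine Finset.sum_congr rfl fun I hI => ?_
  rw [Finset.prod_mul_distrib, Finset.prod_const, (Finset.mem_powersetCard.1 hI).2]

/-! ### Sizes of the nets -/

/-- The integer points of the `ℓ_1` ball of radius `M` are sums of `M` vectors, each of them zero or
plus or minus a unit vector. -/
theorem exists_finset_sum_natAbs_le (κ : Type*) [Fintype κ] [DecidableEq κ] (M : ℕ) :
    ∃ T : Finset (κ → ℤ), T.card ≤ (2 * Fintype.card κ + 1) ^ M ∧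
      ∀ m : κ → ℤ, ∑ i, (m i).natAbs ≤ M → m ∈ T := by
  induction M with
  | zero =>
    refine ⟨{0}, by simp, fun m hm => ?_⟩
    rw [Finset.mem_singleton]
    funext i
    have := (Finset.sum_eq_zero_iff.1 (Nat.le_zero.1 hm)) i (Finset.mem_univ i)
    simpa using this
  | succ M ih =>
    obtain ⟨T, hT, hmem⟩ := ih
    refine ⟨(T ×ˢ (Finset.univ : Finset (Option (κ × ℤˣ)))).image fun x =>
      x.1 + x.2.elim 0 fun y => Pi.single y.1 (y.2 : ℤ), ?_, ?_⟩
    · refine Finset.card_image_le.trans ?_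
      rw [Finset.card_product, pow_succ]
      refine Nat.mul_le_mul hT (le_of_eq ?_)
      rw [Finset.card_univ, Fintype.card_option, Fintype.card_prod, Fintype.card_units_int]
      ring
    · intro m hm
      rw [Finset.mem_image]
      by_cases h0 : ∀ i, m i = 0
      · refine ⟨(m, none), Finset.mem_product.2 ⟨hmem _ ?_, Finset.mem_univ _⟩, by simp⟩
        simp [h0]
      · push Not at h0
        obtain ⟨i, hi⟩ := h0
        obtain ⟨u, hu⟩ : ∃ u : ℤˣ, (m i - u).natAbs + 1 = (m i).natAbs := by
          rcases lt_or_gt_of_ne hi with h | h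
          · exact ⟨-1, by simp; omega⟩
          · exact ⟨1, by simp; omega⟩
        refine ⟨(m - Pi.single i (u : ℤ), some (i, u)),
          Finset.mem_product.2 ⟨hmem _ ?_, Finset.mem_univ _⟩, by simp⟩
        have h1 := Finset.add_sum_erase Finset.univ (fun j => (m j).natAbs) (Finset.mem_univ i)
        have h2 := Finset.add_sum_erase Finset.univ
          (fun j => ((m - Pi.single i (u : ℤ) : κ → ℤ) j).natAbs) (Finset.mem_univ i)
        have h3 : ∑ j ∈ Finset.univ.erase i, ((m - Pi.single i (u : ℤ) : κ → ℤ) j).natAbs =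
            ∑ j ∈ Finset.univ.erase i, (m j).natAbs := by
          refine Finset.sum_congr rfl fun j hj => ?_
          rw [Pi.sub_apply, Pi.single_eq_of_ne (Finset.ne_of_mem_erase hj), sub_zero]
        have h4 : ((m - Pi.single i (u : ℤ) : κ → ℤ) i).natAbs = (m i - u).natAbs := by simp
        simp only [h3, h4] at h2
        change ∑ j, ((m - Pi.single i (u : ℤ) : κ → ℤ) j).natAbs ≤ M
        omega

/-- On the Euclidean ball, integrality gives `∑ |m_p| ≤ ∑ m_p ^ 2 ≤ 4 ^ l` for the rounded point. -/
theorem sum_natAbs_gridIndex_le {n : ℕ} (l : ℕ) {z : Fin n → ℂ} (hz : ∑ i, ‖z i‖ ^ 2 ≤ 1) :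
    ∑ p, (gridIndex l z p).natAbs ≤ 4 ^ l := by
  have hround : ∀ x : ℝ, ((roundTowardZero (2 ^ l / 2 * x)).natAbs : ℝ) ≤ 4 ^ l * x ^ 2 := by
    intro x
    have h1 : ((roundTowardZero (2 ^ l / 2 * x)).natAbs : ℝ) ≤
        |(roundTowardZero (2 ^ l / 2 * x) : ℝ)| ^ 2 := by
      rw [← Int.cast_abs, ← Nat.cast_natAbs]
      exact_mod_cast Nat.le_self_pow two_ne_zero _
    have h2 := pow_le_pow_left₀ (abs_nonneg _) (abs_roundTowardZero_le (2 ^ l / 2 * x)) 2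
    have h3 : |2 ^ l / 2 * x| ^ 2 = 4 ^ l * x ^ 2 / 4 := by
      rw [sq_abs, mul_pow, div_pow, ← pow_mul, mul_comm l 2, pow_mul]
      norm_num
      ring
    have h4 : 0 ≤ (4 : ℝ) ^ l * x ^ 2 := by positivity
    linarith
  have hreal : ((∑ p, (gridIndex l z p).natAbs : ℕ) : ℝ) ≤ 4 ^ l := by
    rw [Fintype.sum_sum_type]
    push_cast
    rw [← Finset.sum_add_distrib]
    calc ∑ i, (((gridIndex l z (Sum.inl i)).natAbs : ℝ) + (gridIndex l z (Sum.inr i)).natAbs)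
        ≤ ∑ i, 4 ^ l * ‖z i‖ ^ 2 := by
          refine Finset.sum_le_sum fun i _ => ?_
          rw [Complex.sq_norm, Complex.normSq_apply]
          have h1 := hround (z i).re
          have h2 := hround (z i).im
          simp only [gridIndex, Sum.elim_inl, Sum.elim_inr]
          linarith
      _ ≤ 4 ^ l := by
          rw [← Finset.mul_sum]
          exact mul_le_of_le_one_right (by positivity) hz
  exact_mod_cast hreal

theorem gridIndex_mem_Icc {n : ℕ} (l : ℕ) {z : Fin n → ℂ} (hz : ∀ i, ‖z i‖ ≤ 1)
    (p : Fin n ⊕ Fin n) : gridIndex l z p ∈ Finset.Icc (-(2 : ℤ) ^ l) (2 ^ l) := by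
  have hround : ∀ x : ℝ, |x| ≤ 1 →
      roundTowardZero (2 ^ l / 2 * x) ∈ Finset.Icc (-(2 : ℤ) ^ l) (2 ^ l) := by
    intro x hx
    have h1 := abs_roundTowardZero_le (2 ^ l / 2 * x)
    have h2 : |2 ^ l / 2 * x| ≤ 2 ^ l := by
      rw [abs_mul, abs_of_pos (by positivity : (0 : ℝ) < 2 ^ l / 2)]
      have h3 : (0 : ℝ) < 2 ^ l := by positivity
      nlinarith
    have h3 : |roundTowardZero (2 ^ l / 2 * x)| ≤ 2 ^ l := by exact_mod_cast h1.trans h2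
    exact Finset.mem_Icc.2 (abs_le.1 h3)
  rcases p with i | i
  · exact hround _ ((Complex.abs_re_le_norm _).trans (hz i))
  · exact hround _ ((Complex.abs_im_le_norm _).trans (hz i))

theorem card_piFinset_Icc_le (n l : ℕ) :
    ((Fintype.piFinset fun _ : Fin n ⊕ Fin n => Finset.Icc (-(2 : ℤ) ^ l) (2 ^ l)).card : ℝ) ≤
      Real.exp (2 * n * (l + 2)) := by
  have h1 : (Finset.Icc (-(2 : ℤ) ^ l) (2 ^ l)).card ≤ 2 ^ (l + 2) := by
    rw [Int.card_Icc, Int.toNat_le]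
    push_cast
    have : (1 : ℤ) ≤ 2 ^ l := one_le_pow₀ (by norm_num)
    rw [pow_add]
    linarith
  have h2 : (2 : ℝ) ≤ Real.exp 1 := by linarith [Real.add_one_le_exp (1 : ℝ)]
  rw [Fintype.card_piFinset, Finset.prod_const, Finset.card_univ, Fintype.card_sum,
    Fintype.card_fin]
  calc (((Finset.Icc (-(2 : ℤ) ^ l) (2 ^ l)).card ^ (n + n) : ℕ) : ℝ)
      ≤ ((2 ^ (l + 2)) ^ (n + n) : ℕ) := by exact_mod_cast Nat.pow_le_pow_left h1 _
    _ = 2 ^ ((l + 2) * (n + n)) := by push_cast; rw [pow_mul]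
    _ ≤ Real.exp 1 ^ ((l + 2) * (n + n)) := pow_le_pow_left₀ zero_le_two h2 _
    _ = Real.exp (2 * n * (l + 2)) := by
        rw [← Real.exp_nat_mul]; push_cast; ring_nf

/-! ### Bounds on `ℓ_1`, `ℓ_2` and `ℓ_∞` -/

theorem IsPartialSteinerSystem.card_le_pow {t k n : ℕ} {S : Finset (Finset (Fin n))}
    (hS : IsPartialSteinerSystem t k n S) : S.card ≤ n ^ k := by
  have hsub : S ⊆ Finset.powersetCard k Finset.univ := fun J hJ =>
    Finset.mem_powersetCard.2 ⟨Finset.subset_univ _, hS.1 J hJ⟩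
  refine (Finset.card_le_card hsub).trans ?_
  rw [Finset.card_powersetCard, Finset.card_univ, Fintype.card_fin]
  exact Nat.choose_le_pow _ _

theorem IsPartialSteinerSystem.norm_signedSum_le_of_sum_norm_le_one {t k n : ℕ}
    {S : Finset (Finset (Fin n))} (hS : IsPartialSteinerSystem t k n S)
    (c : Finset (Fin n) → ℤˣ) {z : Fin n → ℂ} (hz : ∑ i, ‖z i‖ ≤ 1) :
    ‖signedSum S c z‖ ≤ Real.exp 2 * (1 / 2) ^ k := by
  have hsub : S ⊆ Finset.powersetCard k Finset.univ := fun J hJ =>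
    Finset.mem_powersetCard.2 ⟨Finset.subset_univ _, hS.1 J hJ⟩
  have h1 : ‖signedSum S c z‖ ≤
      ∑ J ∈ Finset.powersetCard k Finset.univ, ∏ j ∈ J, ‖z j‖ := by
    refine (norm_sum_le_of_le (f := fun J => ((c J : ℤ) : ℂ) * ∏ j ∈ J, z j) S
      (n := fun J => ∏ j ∈ J, ‖z j‖) fun J _ => ?_).trans
      (Finset.sum_le_sum_of_subset_of_nonneg hsub
        fun J _ _ => Finset.prod_nonneg fun _ _ => norm_nonneg _)
    rw [norm_intUnits_mul, norm_prod]
  have h2 := pow_mul_sum_powersetCard_prod_le_exp k (t := 2) zero_le_two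
    (x := fun i => ‖z i‖) fun i => norm_nonneg _
  have h3 : Real.exp (2 * ∑ i, ‖z i‖) ≤ Real.exp 2 := Real.exp_le_exp.2 (by linarith)
  rw [one_div, inv_pow, ← div_eq_mul_inv, le_div_iff₀ (by positivity), mul_comm]
  exact ((mul_le_mul_of_nonneg_left h1 (by positivity)).trans h2).trans h3

theorem clog_two_le {n : ℕ} (hn : 2 ≤ n) : (Nat.clog 2 n : ℝ) ≤ 3 * Real.log n := by
  have h1 : 2 ^ (Nat.clog 2 n).pred < n := Nat.pow_pred_clog_lt_self one_lt_two hn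
  have h2 : 0 < Nat.clog 2 n := Nat.clog_pos one_lt_two hn
  have h3 : (Nat.clog 2 n : ℝ) = ((Nat.clog 2 n).pred : ℝ) + 1 := by
    exact_mod_cast (Nat.succ_pred_eq_of_pos h2).symm
  have h4 : ((Nat.clog 2 n).pred : ℝ) * Real.log 2 ≤ Real.log n := by
    rw [← Real.log_pow]
    exact Real.log_le_log (by positivity) (by exact_mod_cast h1.le)
  have h5 : Real.log 2 ≤ Real.log n := Real.log_le_log two_pos (by exact_mod_cast hn)
  have h6 := Real.log_two_gt_d9
  rw [h3]
  nlinarith [Nat.cast_nonneg (α := ℝ) (Nat.clog 2 n).pred]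

/-- With `k * clog 2 n` levels the deterministic error at the end of the chain is harmless. -/
theorem IsPartialSteinerSystem.card_mul_half_pow_le {t k n : ℕ} {S : Finset (Finset (Fin n))}
    (hS : IsPartialSteinerSystem t k n S) :
    (S.card : ℝ) * (1 / 2) ^ (k * Nat.clog 2 n) ≤ 1 := by
  rw [one_div, inv_pow, ← div_eq_mul_inv, div_le_one (by positivity)]
  have h1 : n ^ k ≤ 2 ^ (k * Nat.clog 2 n) := by
    rw [mul_comm, pow_mul]
    exact Nat.pow_le_pow_left (Nat.le_pow_clog one_lt_two n) k
  exact_mod_cast hS.card_le_pow.trans h1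

/-- On the Euclidean ball every level of the chain contributes `O(√(log n))`: the entropy grows like
`4 ^ l` and compensates the decay of the variance. -/
theorem deviation_four_pow_log_le {n : ℕ} (hn : 2 ≤ n) (l : ℕ) :
    deviation (fun l => 4 ^ l * Real.log (4 * n + 1)) l * (1 / 2) ^ l ≤ 8 * √(Real.log n) := by
  have hn' : (2 : ℝ) ≤ n := by exact_mod_cast hn
  have hlog2 := Real.log_two_gt_d9
  have hL : Real.log 2 ≤ Real.log n := Real.log_le_log two_pos hn'
  have h4 : Real.log (4 * n + 1) ≤ 4 * Real.log n := by
    have : Real.log ((n : ℝ) ^ 4) = 4 * Real.log n := by rw [Real.log_pow]; norm_num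
    rw [← this]
    refine Real.log_le_log (by positivity) ?_
    nlinarith [pow_le_pow_left₀ (by norm_num) hn' 3]
  have hl : ((l : ℝ) + 4) ≤ 4 * 4 ^ l := by
    have h : l < 4 ^ l := Nat.lt_pow_self (by norm_num)
    have h' : (l : ℝ) + 1 ≤ 4 ^ l := by exact_mod_cast h
    have : (1 : ℝ) ≤ 4 ^ l := one_le_pow₀ (by norm_num)
    linarith
  have hpow : (0 : ℝ) < 4 ^ l := by positivity
  have hsq : 2 * (4 ^ (l + 1) * Real.log (4 * n + 1) + 4 ^ l * Real.log (4 * n + 1) +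
      ((l : ℝ) + 4)) ≤ (2 ^ l * (8 * √(Real.log n))) ^ 2 := by
    rw [mul_pow, mul_pow, Real.sq_sqrt (by linarith), ← pow_mul, mul_comm l 2, pow_mul]
    norm_num only
    rw [pow_succ]
    nlinarith [mul_le_mul_of_nonneg_left h4 hpow.le, mul_le_mul_of_nonneg_left hL hpow.le,
      mul_le_mul_of_nonneg_left hlog2.le hpow.le]
  have h := Real.sqrt_le_sqrt hsq
  rw [Real.sqrt_sq (by positivity)] at h
  rw [one_div, inv_pow, ← div_eq_mul_inv, div_le_iff₀ (by positivity)]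
  exact h.trans_eq (mul_comm _ _)

/-- On the polydisc the entropy grows linearly in the level, so that the sum over all levels
converges and there is no logarithmic loss. -/
theorem deviation_polydisc_le {n : ℕ} (hn : 1 ≤ n) (l : ℕ) :
    deviation (fun l => 2 * n * ((l : ℝ) + 2)) l ≤ 6 * √n * (l + 1) := by
  have hn' : (1 : ℝ) ≤ n := by exact_mod_cast hn
  have hl : (0 : ℝ) ≤ l := Nat.cast_nonneg l
  rw [deviation, Real.sqrt_le_left (by positivity), mul_pow, mul_pow, Real.sq_sqrt (by positivity)]
  push_cast
  nlinarith [mul_nonneg hl (sub_nonneg.2 hn'), mul_nonneg (mul_nonneg hl hl) (sub_nonneg.2 hn'),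
    mul_nonneg hl hl]

theorem sum_succ_mul_half_pow_le (K : ℕ) :
    ∑ l ∈ Finset.range K, ((l : ℝ) + 1) * (1 / 2) ^ l ≤ 4 := by
  have h : ∑ l ∈ Finset.range K, ((l : ℝ) + 1) * (1 / 2) ^ l =
      4 - (2 * K + 4) * (1 / 2) ^ K := by
    induction K with
    | zero => norm_num
    | succ K ih => rw [Finset.sum_range_succ, ih, pow_succ]; push_cast; ring
  rw [h]
  have : (0 : ℝ) ≤ (2 * K + 4) * (1 / 2) ^ K := by positivity
  linarith

/-- More than half of the signs give a polynomial of norm `O(k² (log n)^{3/2})` on `ℓ_2^n`. -/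
theorem exists_bad_signs_euclidean {k n : ℕ} (hk : 2 ≤ k) (hn : 2 ≤ n)
    {S : Finset (Finset (Fin n))} (hS : IsPartialSteinerSystem (k - 1) k n S) :
    ∃ bad : Finset (Finset (Fin n) → ℤˣ),
      2 * bad.card < Fintype.card (Finset (Fin n) → ℤˣ) ∧
      ∀ c ∉ bad, ∀ z : Fin n → ℂ, ∑ i, ‖z i‖ ^ 2 ≤ 1 →
        ‖signedSum S c z‖ ≤ 1000 * k ^ 2 * (Real.log n * √(Real.log n)) := by
  have hk' : (2 : ℝ) ≤ k := by exact_mod_cast hk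
  have hn' : (2 : ℝ) ≤ n := by exact_mod_cast hn
  set D : ℝ := √(k * Real.exp 2) with hD
  have hDpos : 0 < D := Real.sqrt_pos.2 (by positivity)
  choose T hT hTmem using fun l : ℕ => exists_finset_sum_natAbs_le (Fin n ⊕ Fin n) (4 ^ l)
  have hTexp : ∀ l, ((T l).card : ℝ) ≤ Real.exp (4 ^ l * Real.log (4 * n + 1)) := by
    intro l
    have h1 : ((T l).card : ℝ) ≤ (4 * n + 1) ^ 4 ^ l := by
      have h2 := hT l
      rw [Fintype.card_sum, Fintype.card_fin] at h2
      calc ((T l).card : ℝ) ≤ (((2 * (n + n) + 1) ^ 4 ^ l : ℕ) : ℝ) := by exact_mod_cast h2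
        _ = (4 * n + 1) ^ 4 ^ l := by push_cast; ring_nf
    refine h1.trans (le_of_eq ?_)
    have h3 : (4 : ℝ) ^ l = ((4 ^ l : ℕ) : ℝ) := by push_cast; rfl
    rw [h3, Real.exp_nat_mul, Real.exp_log (by positivity)]
  obtain ⟨bad, hbad, hgood⟩ := exists_bad_signs_chaining (S := S)
    (fun J hJ => Finset.card_pos.1 (by rw [hS.1 J hJ]; omega))
    (B := {z : Fin n → ℂ | ∑ i, ‖z i‖ ^ 2 ≤ 1}) hDpos
    (fun z hz w hw => (Finset.sum_le_sum fun i _ =>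
      pow_le_pow_left₀ (norm_nonneg _) (hw i) 2).trans hz)
    (fun z hz i => by
      have h1 : ‖z i‖ ^ 2 ≤ 1 := (Finset.single_le_sum (f := fun i => ‖z i‖ ^ 2)
        (fun _ _ => by positivity) (Finset.mem_univ i)).trans hz
      exact (sq_le_one_iff₀ (norm_nonneg _)).1 h1)
    (fun z hz w hw ε hε h => by
      have h1 := hS.sum_norm_prod_sub_prod_sq_le (a := fun i => max ‖z i‖ ‖w i‖)
        (fun i => le_max_left _ _) (fun i => le_max_right _ _) h
      have h2 : ∑ i, (max ‖z i‖ ‖w i‖) ^ 2 ≤ 2 := by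
        have h3 : ∀ i, (max ‖z i‖ ‖w i‖) ^ 2 ≤ ‖z i‖ ^ 2 + ‖w i‖ ^ 2 := fun i => by
          rcases max_choice ‖z i‖ ‖w i‖ with h | h <;> rw [h] <;>
            nlinarith [sq_nonneg ‖z i‖, sq_nonneg ‖w i‖]
        have h4 := Finset.sum_le_sum fun i (_ : i ∈ Finset.univ) => h3 i
        rw [Finset.sum_add_distrib] at h4
        have hz' : ∑ i, ‖z i‖ ^ 2 ≤ 1 := hz
        have hw' : ∑ i, ‖w i‖ ^ 2 ≤ 1 := hw
        linarith
      have h5 := pow_mul_sum_powersetCard_prod_le_exp (k - 1) (t := 1) zero_le_one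
        (x := fun i => (max ‖z i‖ ‖w i‖) ^ 2) fun i => sq_nonneg _
      rw [one_pow, one_mul, one_mul] at h5
      rw [mul_pow, hD, Real.sq_sqrt (by positivity)]
      refine h1.trans ?_
      gcongr
      exact h5.trans (Real.exp_le_exp.2 h2))
    (h := fun l => 4 ^ l * Real.log (4 * n + 1))
    (fun l => mul_nonneg (by positivity) (Real.log_nonneg (by linarith))) hTexp
    (fun l z hz => hTmem l _ (sum_natAbs_gridIndex_le l hz)) (k * Nat.clog 2 n)
  refine ⟨bad, hbad, fun c hc z hz => (hgood c hc z hz).trans ?_⟩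
  have hL : 1 / 2 ≤ Real.log n := by
    have := Real.log_two_gt_d9
    have : Real.log 2 ≤ Real.log n := Real.log_le_log two_pos hn'
    linarith
  have hsL : 1 / 2 ≤ √(Real.log n) := Real.le_sqrt_of_sq_le (by linarith)
  have hD3 : D ≤ 3 * k := by
    rw [hD, Real.sqrt_le_left (by positivity)]
    have : Real.exp 2 ≤ 9 := by
      have h1 : Real.exp 2 = Real.exp 1 ^ 2 := by rw [← Real.exp_nat_mul]; norm_num
      have h2 := Real.exp_one_lt_d9
      rw [h1]
      nlinarith [Real.exp_pos 1]
    nlinarith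
  have hsum : ∑ l ∈ Finset.range (k * Nat.clog 2 n),
      2 * deviation (fun l => 4 ^ l * Real.log (4 * n + 1)) l * (D * (6 * (1 / 2) ^ l)) ≤
      (k * (3 * Real.log n)) * (96 * D * √(Real.log n)) := by
    calc _ ≤ ∑ l ∈ Finset.range (k * Nat.clog 2 n), 96 * D * √(Real.log n) := by
          refine Finset.sum_le_sum fun l _ => ?_
          nlinarith [mul_le_mul_of_nonneg_left (deviation_four_pow_log_le hn l) hDpos.le]
      _ = (k * Nat.clog 2 n : ℕ) * (96 * D * √(Real.log n)) := by
          rw [Finset.sum_const, Finset.card_range, nsmul_eq_mul]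
      _ ≤ _ := by
          push_cast
          gcongr
          exact clog_two_le hn
  have htail : (S.card : ℝ) * (D * (4 * (1 / 2) ^ (k * Nat.clog 2 n))) ≤ 4 * D := by
    nlinarith [mul_le_mul_of_nonneg_left hS.card_mul_half_pow_le hDpos.le]
  have hLs : 1 / 4 ≤ Real.log n * √(Real.log n) := by nlinarith
  have hkLs : 1 / 4 ≤ k * (Real.log n * √(Real.log n)) := by nlinarith
  have hfinal : k * (Real.log n * √(Real.log n)) * D ≤
      k * (Real.log n * √(Real.log n)) * (3 * k) :=
    mul_le_mul_of_nonneg_left hD3 (by linarith)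
  nlinarith [mul_le_mul_of_nonneg_right hkLs hDpos.le]

theorem mul_pow_div_factorial_le {k n : ℕ} (hk : 1 ≤ k) :
    (n : ℝ) * (k * ((n : ℝ) ^ (k - 1) / (k - 1).factorial)) ≤
      (Real.exp 8 * ((1 / 2) ^ k * √((n : ℝ) ^ k))) ^ 2 := by
  obtain ⟨m, rfl⟩ : ∃ m, k = m + 1 := ⟨k - 1, by omega⟩
  have h1 := Real.pow_div_factorial_le_exp (x := 16) (by norm_num) (m + 1)
  have h2 : ((m + 1 : ℕ) : ℝ) ^ 2 ≤ 4 ^ (m + 1) := by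
    have h3 : ((m + 1 : ℕ) : ℝ) ≤ 2 ^ (m + 1) := by
      exact_mod_cast (Nat.lt_pow_self (n := m + 1) one_lt_two).le
    have h4 := pow_le_pow_left₀ (by positivity) h3 2
    rwa [← pow_mul, mul_comm (m + 1) 2, pow_mul, (by norm_num : (2 : ℝ) ^ 2 = 4)] at h4
  have h5 : (0 : ℝ) < (m + 1).factorial := by positivity
  have h6 : ((m + 1 : ℕ) : ℝ) / (m.factorial : ℝ) ≤ Real.exp 16 * (1 / 4) ^ (m + 1) := by
    have h7 : ((m + 1 : ℕ) : ℝ) / (m.factorial : ℝ) =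
        ((m + 1 : ℕ) : ℝ) ^ 2 / (m + 1).factorial := by
      rw [Nat.factorial_succ]
      push_cast
      field_simp
    rw [h7, one_div, inv_pow, ← div_eq_mul_inv, le_div_iff₀ (by positivity)]
    refine le_trans ?_ h1
    rw [div_mul_eq_mul_div]
    gcongr
    calc ((m + 1 : ℕ) : ℝ) ^ 2 * 4 ^ (m + 1) ≤ 4 ^ (m + 1) * 4 ^ (m + 1) := by gcongr
      _ = 16 ^ (m + 1) := by rw [← mul_pow]; norm_num
  have h8 : (Real.exp 8 * ((1 / 2) ^ (m + 1) * √((n : ℝ) ^ (m + 1)))) ^ 2 =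
      Real.exp 16 * (1 / 4) ^ (m + 1) * (n : ℝ) ^ (m + 1) := by
    rw [mul_pow, mul_pow, Real.sq_sqrt (by positivity), ← Real.exp_nat_mul, ← pow_mul,
      mul_comm (m + 1) 2, pow_mul]
    norm_num
    ring
  rw [h8, Nat.add_sub_cancel]
  calc (n : ℝ) * (((m + 1 : ℕ) : ℝ) * ((n : ℝ) ^ m / m.factorial))
      = ((m + 1 : ℕ) : ℝ) / (m.factorial : ℝ) * (n : ℝ) ^ (m + 1) := by ring
    _ ≤ _ := by gcongr

/-- More than half of the signs give a polynomial of norm `O(2^{-k} n^{k/2})` on `ℓ_∞^n`. -/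
theorem exists_bad_signs_polydisc {k n : ℕ} (hk : 2 ≤ k) (hn : 1 ≤ n)
    {S : Finset (Finset (Fin n))} (hS : IsPartialSteinerSystem (k - 1) k n S) :
    ∃ bad : Finset (Finset (Fin n) → ℤˣ),
      2 * bad.card < Fintype.card (Finset (Fin n) → ℤˣ) ∧
      ∀ c ∉ bad, ∀ z : Fin n → ℂ, (∀ i, ‖z i‖ ≤ 1) →
        ‖signedSum S c z‖ ≤ 292 * Real.exp 8 * ((1 / 2) ^ k * √((n : ℝ) ^ k)) := by
  have hn' : (1 : ℝ) ≤ n := by exact_mod_cast hn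
  set D : ℝ := √(k * ((n : ℝ) ^ (k - 1) / (k - 1).factorial)) with hD
  have hDpos : 0 < D := Real.sqrt_pos.2 (by positivity)
  obtain ⟨bad, hbad, hgood⟩ := exists_bad_signs_chaining (S := S)
    (fun J hJ => Finset.card_pos.1 (by rw [hS.1 J hJ]; omega))
    (B := {z : Fin n → ℂ | ∀ i, ‖z i‖ ≤ 1}) hDpos
    (fun z hz w hw i => (hw i).trans (hz i)) (fun z hz => hz)
    (fun z hz w hw ε hε h => by
      refine (hS.sum_norm_prod_sub_prod_sq_le (a := fun _ => 1) hz hw h).trans ?_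
      rw [mul_pow, hD, Real.sq_sqrt (by positivity)]
      gcongr
      simp only [one_pow, Finset.prod_const_one, Finset.sum_const, nsmul_eq_mul, mul_one,
        Finset.card_powersetCard, Finset.card_univ, Fintype.card_fin]
      exact Nat.choose_le_pow_div _ _)
    (h := fun l => 2 * n * ((l : ℝ) + 2)) (fun l => by positivity)
    (T := fun l => Fintype.piFinset fun _ => Finset.Icc (-(2 : ℤ) ^ l) (2 ^ l))
    (fun l => card_piFinset_Icc_le n l)
    (fun l z hz => Fintype.mem_piFinset.2 (gridIndex_mem_Icc l hz)) (k * Nat.clog 2 n)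
  refine ⟨bad, hbad, fun c hc z hz => (hgood c hc z hz).trans ?_⟩
  have hsum : ∑ l ∈ Finset.range (k * Nat.clog 2 n),
      2 * deviation (fun l => 2 * n * ((l : ℝ) + 2)) l * (D * (6 * (1 / 2) ^ l)) ≤
      72 * √n * D * 4 := by
    calc _ ≤ ∑ l ∈ Finset.range (k * Nat.clog 2 n),
          72 * √n * D * (((l : ℝ) + 1) * (1 / 2) ^ l) := by
          refine Finset.sum_le_sum fun l _ => ?_
          calc _ ≤ 2 * (6 * √n * (l + 1)) * (D * (6 * (1 / 2) ^ l)) := by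
                gcongr
                exact deviation_polydisc_le hn l
            _ = _ := by ring
      _ ≤ _ := by
          rw [← Finset.mul_sum]
          gcongr
          exact sum_succ_mul_half_pow_le _
  have htail : (S.card : ℝ) * (D * (4 * (1 / 2) ^ (k * Nat.clog 2 n))) ≤ 4 * D := by
    nlinarith [mul_le_mul_of_nonneg_left hS.card_mul_half_pow_le hDpos.le]
  have hsn : 1 ≤ √(n : ℝ) := Real.one_le_sqrt.2 hn'
  have hnD : √(n : ℝ) * D ≤ Real.exp 8 * ((1 / 2) ^ k * √((n : ℝ) ^ k)) := by
    rw [hD, ← Real.sqrt_mul (by positivity), Real.sqrt_le_left (by positivity)]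
    exact mul_pow_div_factorial_le (by omega)
  nlinarith

/-! ### Interpolation -/

/-- The point with coordinates `z_i |z_i|^{e-1}`, whose moduli are `|z_i|^{Re e}`, as an entire
function of `e`. The power is written with `exp` and `log` so that zero coordinates stay zero for
every `e`, including `Re e = 0`. -/
noncomputable def powerPath {n : ℕ} (z : Fin n → ℂ) (e : ℂ) : Fin n → ℂ :=
  fun i => z i * Complex.exp ((e - 1) * (Real.log ‖z i‖ : ℂ))

theorem powerPath_one {n : ℕ} (z : Fin n → ℂ) : powerPath z 1 = z := by
  funext i
  simp [powerPath]

theorem norm_powerPath_apply {n : ℕ} {z : Fin n → ℂ} (e : ℂ) {i : Fin n} (hi : z i ≠ 0) :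
    ‖powerPath z e i‖ = ‖z i‖ ^ e.re := by
  have h : 0 < ‖z i‖ := norm_pos_iff.2 hi
  rw [powerPath, norm_mul, Complex.norm_exp, Real.rpow_def_of_pos h]
  nth_rewrite 1 [← Real.exp_log h]
  rw [← Real.exp_add, Complex.re_mul_ofReal]
  congr 1
  simp
  ring

theorem norm_powerPath_apply_le {n : ℕ} (z : Fin n → ℂ) (e : ℂ) (i : Fin n) :
    ‖powerPath z e i‖ ≤ ‖z i‖ ^ e.re := by
  by_cases hi : z i = 0
  · simp only [powerPath, hi, zero_mul, norm_zero]
    exact Real.rpow_nonneg le_rfl _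
  · exact (norm_powerPath_apply e hi).le

/-- Polynomial norms on `ℓ_q^n` are logarithmically convex in `1 / q`, by the three lines theorem
applied to the polynomial along `powerPath`. Here `α` and `α + β` are the quotients of `q` by the
two exponents between which one interpolates. -/
theorem norm_signedSum_le_interpolate {n : ℕ} (S : Finset (Finset (Fin n)))
    (c : Finset (Fin n) → ℤˣ) {z : Fin n → ℂ} {α β θ a b : ℝ} (hz : ∀ i, ‖z i‖ ≤ 1)
    (hα : 0 ≤ α) (hαβ : 0 ≤ α + β) (hθ0 : 0 ≤ θ) (hθ1 : θ ≤ 1) (hθ : α + β * θ = 1)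
    (ha : ∀ ζ : Fin n → ℂ, (∀ i, ‖ζ i‖ ≤ ‖z i‖ ^ α) → ‖signedSum S c ζ‖ ≤ a)
    (hb : ∀ ζ : Fin n → ℂ, (∀ i, ‖ζ i‖ ≤ ‖z i‖ ^ (α + β)) → ‖signedSum S c ζ‖ ≤ b) :
    ‖signedSum S c z‖ ≤ a ^ (1 - θ) * b ^ θ := by
  set f : ℂ → ℂ := fun w => signedSum S c (powerPath z (α + β * w)) with hf
  have hre : ∀ w : ℂ, ((α : ℂ) + β * w).re = α + β * w.re := fun w => by simp
  have hdiff : Differentiable ℂ f := by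
    simp only [hf, signedSum, powerPath]
    fun_prop
  have hbdd : BddAbove ((norm ∘ f) '' Complex.HadamardThreeLines.verticalClosedStrip 0 1) := by
    refine ⟨S.card, ?_⟩
    rintro _ ⟨w, hw, rfl⟩
    have hw' : 0 ≤ w.re ∧ w.re ≤ 1 := hw
    rw [← nsmul_one]
    refine (norm_sum_le_of_le (n := fun _ => (1 : ℝ)) _ fun J _ => ?_).trans_eq
      (Finset.sum_const _)
    rw [norm_intUnits_mul, norm_prod]
    refine Finset.prod_le_one (fun _ _ => norm_nonneg _) fun i _ => ?_
    refine (norm_powerPath_apply_le z _ i).trans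
      (Real.rpow_le_one (norm_nonneg _) (hz i) ?_)
    rw [hre]
    nlinarith
  have h := Complex.HadamardThreeLines.norm_le_interp_of_mem_verticalClosedStrip₀₁' f
    (z := (θ : ℂ)) (a := a) (b := b) (by
      change (θ : ℂ).re ∈ Set.Icc (0 : ℝ) 1
      exact ⟨by simpa using hθ0, by simpa using hθ1⟩)
    hdiff.diffContOnCl hbdd
    (fun w hw => ha _ fun i => by
      have hw0 : w.re = 0 := hw
      have := norm_powerPath_apply_le z (α + β * w) i
      rwa [hre, hw0, mul_zero, add_zero] at this)
    (fun w hw => hb _ fun i => by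
      have hw1 : w.re = 1 := hw
      have := norm_powerPath_apply_le z (α + β * w) i
      rwa [hre, hw1, mul_one] at this)
  have hone : (α : ℂ) + β * θ = 1 := by exact_mod_cast hθ
  simpa only [hf, hone, powerPath_one, Complex.ofReal_re] using h

theorem norm_le_one_of_sum_rpow_le_one {n : ℕ} {q : ℝ} (hq : 0 < q) {z : Fin n → ℂ}
    (hz : ∑ i, ‖z i‖ ^ q ≤ 1) (i : Fin n) : ‖z i‖ ≤ 1 := by
  have h : ‖z i‖ ^ q ≤ 1 := (Finset.single_le_sum (f := fun i => ‖z i‖ ^ q)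
    (fun _ _ => Real.rpow_nonneg (norm_nonneg _) _) (Finset.mem_univ i)).trans hz
  by_contra! hcon
  exact absurd h (not_le.2 (Real.one_lt_rpow hcon hq))

theorem sum_sq_le_one_of_norm_le_rpow {n : ℕ} {q : ℝ} {z ζ : Fin n → ℂ}
    (hz : ∑ i, ‖z i‖ ^ q ≤ 1) (h : ∀ i, ‖ζ i‖ ≤ ‖z i‖ ^ (q / 2)) : ∑ i, ‖ζ i‖ ^ 2 ≤ 1 := by
  refine (Finset.sum_le_sum fun i _ => ?_).trans hz
  refine (pow_le_pow_left₀ (norm_nonneg _) (h i) 2).trans_eq ?_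
  rw [← Real.rpow_natCast, ← Real.rpow_mul (norm_nonneg _)]
  norm_num

theorem norm_signedSum_le_of_two_le {n : ℕ} (S : Finset (Finset (Fin n)))
    (c : Finset (Fin n) → ℤˣ) {a b q : ℝ} (hq : 2 ≤ q)
    (ha : ∀ ζ : Fin n → ℂ, (∀ i, ‖ζ i‖ ≤ 1) → ‖signedSum S c ζ‖ ≤ a)
    (hb : ∀ ζ : Fin n → ℂ, ∑ i, ‖ζ i‖ ^ 2 ≤ 1 → ‖signedSum S c ζ‖ ≤ b)
    {z : Fin n → ℂ} (hz : ∑ i, ‖z i‖ ^ q ≤ 1) :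
    ‖signedSum S c z‖ ≤ a ^ (1 - 2 / q) * b ^ (2 / q) := by
  -- Between `ℓ_∞` (`q / ∞ = 0`) and `ℓ_2`.
  refine norm_signedSum_le_interpolate S c (α := 0) (β := q / 2)
    (norm_le_one_of_sum_rpow_le_one (by linarith) hz) le_rfl (by linarith) (by positivity)
    ((div_le_one (by linarith)).2 hq) (by field_simp; norm_num) (fun ζ hζ => ha ζ ?_)
    (fun ζ hζ => hb ζ ?_)
  · simpa using hζ
  · rw [zero_add] at hζ
    exact sum_sq_le_one_of_norm_le_rpow hz hζ

theorem norm_signedSum_le_of_le_two {n : ℕ} (S : Finset (Finset (Fin n)))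
    (c : Finset (Fin n) → ℤˣ) {a b q : ℝ} (hq1 : 1 ≤ q) (hq2 : q ≤ 2)
    (ha : ∀ ζ : Fin n → ℂ, ∑ i, ‖ζ i‖ ≤ 1 → ‖signedSum S c ζ‖ ≤ a)
    (hb : ∀ ζ : Fin n → ℂ, ∑ i, ‖ζ i‖ ^ 2 ≤ 1 → ‖signedSum S c ζ‖ ≤ b)
    {z : Fin n → ℂ} (hz : ∑ i, ‖z i‖ ^ q ≤ 1) :
    ‖signedSum S c z‖ ≤ a ^ (1 - (2 - 2 / q)) * b ^ (2 - 2 / q) := by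
  have h2q : 1 ≤ 2 / q := (one_le_div (by linarith)).2 hq2
  have h2q' : 2 / q ≤ 2 := div_le_self zero_le_two hq1
  -- Between `ℓ_1` and `ℓ_2`.
  refine norm_signedSum_le_interpolate S c (α := q) (β := -(q / 2))
    (norm_le_one_of_sum_rpow_le_one (by linarith) hz) (by linarith) (by linarith) (by linarith)
    (by linarith) (by field_simp; ring) (fun ζ hζ => ha ζ ?_) (fun ζ hζ => hb ζ ?_)
  · exact (Finset.sum_le_sum fun i _ => hζ i).trans hz
  · rw [(by ring : q + -(q / 2) = q / 2)] at hζ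
    exact sum_sq_le_one_of_norm_le_rpow hz hζ

/-! ### Conclusion -/

theorem eval_steinerPolynomial {n : ℕ} (S : Finset (Finset (Fin n)))
    (c : Finset (Fin n) → ℤˣ) (z : Fin n → ℂ) :
    MvPolynomial.eval z (steinerPolynomial S fun J => (c J : ℤ)) = signedSum S c z := by
  simp [steinerPolynomial, signedSum]

theorem polyNorm_steinerPolynomial_le {n : ℕ} (S : Finset (Finset (Fin n)))
    (c : Finset (Fin n) → ℤˣ) {q M : ℝ} (hq : 1 ≤ q) (hM : 0 ≤ M)
    (h : ∀ z : Fin n → ℂ, ∑ i, ‖z i‖ ^ q ≤ 1 → ‖signedSum S c z‖ ≤ M) :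
    polyNorm (ENNReal.ofReal q) (steinerPolynomial S fun J => (c J : ℤ)) ≤ M := by
  refine Real.sSup_le ?_ hM
  rintro _ ⟨z, hz, rfl⟩
  rw [eval_steinerPolynomial]
  refine h _ ?_
  have hq0 : 0 < q := by linarith
  have hq' : (ENNReal.ofReal q).toReal = q := ENNReal.toReal_ofReal hq0.le
  rw [PiLp.norm_eq_sum (by rw [hq']; exact hq0), hq'] at hz
  have hnn : 0 ≤ ∑ i, ‖z i‖ ^ q := Finset.sum_nonneg fun i _ => Real.rpow_nonneg (norm_nonneg _) _
  by_contra! hcon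
  exact absurd hz (not_le.2 (Real.one_lt_rpow hcon (by positivity)))

/-- One choice of signs controls the norms on `ℓ_1^n`, `ℓ_2^n` and `ℓ_∞^n`. -/
theorem exists_signs {k n : ℕ} (hk : 2 ≤ k) (hn : 2 ≤ n) {S : Finset (Finset (Fin n))}
    (hS : IsPartialSteinerSystem (k - 1) k n S) :
    ∃ c : Finset (Fin n) → ℤˣ,
      (∀ z : Fin n → ℂ, ∑ i, ‖z i‖ ≤ 1 → ‖signedSum S c z‖ ≤ 292 * Real.exp 8 * (1 / 2) ^ k) ∧
      (∀ z : Fin n → ℂ, ∑ i, ‖z i‖ ^ 2 ≤ 1 →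
        ‖signedSum S c z‖ ≤ 1000 * k ^ 2 * Real.log n ^ (3 / 2 : ℝ)) ∧
      (∀ z : Fin n → ℂ, (∀ i, ‖z i‖ ≤ 1) →
        ‖signedSum S c z‖ ≤ 292 * Real.exp 8 * (1 / 2) ^ k * (n : ℝ) ^ ((k : ℝ) / 2)) := by
  classical
  obtain ⟨bad₁, h₁, hc₁⟩ := exists_bad_signs_euclidean hk hn hS
  obtain ⟨bad₂, h₂, hc₂⟩ := exists_bad_signs_polydisc hk (by omega) hS
  obtain ⟨c, hc⟩ : ∃ c, c ∉ bad₁ ∪ bad₂ := by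
    by_contra! hall
    have h3 := Finset.card_union_le bad₁ bad₂
    rw [Finset.eq_univ_iff_forall.2 hall, Finset.card_univ] at h3
    omega
  rw [Finset.mem_union, not_or] at hc
  have hlog : 0 < Real.log n := Real.log_pos (by exact_mod_cast hn)
  refine ⟨c, fun z hz => ?_, fun z hz => ?_, fun z hz => ?_⟩
  · refine (hS.norm_signedSum_le_of_sum_norm_le_one c hz).trans ?_
    have h1 : Real.exp 2 ≤ Real.exp 8 := Real.exp_le_exp.2 (by norm_num)
    have h2 := Real.exp_pos 8
    gcongr
    linarith
  · refine (hc₁ c hc.1 z hz).trans_eq ?_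
    rw [(by norm_num : (3 / 2 : ℝ) = 1 + 1 / 2), Real.rpow_add hlog, Real.rpow_one,
      Real.sqrt_eq_rpow]
  · refine (hc₂ c hc.2 z hz).trans_eq ?_
    rw [Real.sqrt_eq_rpow, ← Real.rpow_natCast (n : ℝ) k, ← Real.rpow_mul (Nat.cast_nonneg n)]
    ring_nf

/-- Polynomial growth in `k`, at the endpoint `ℓ_2`, is compensated by exponential decay at the
other endpoint as soon as the latter carries some weight. -/
theorem exists_interpolated_constant {θ : ℝ} (h1 : θ < 1) :
    ∃ C : ℝ, 0 < C ∧ ∀ k : ℕ, 2 ≤ k →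
      (292 * Real.exp 8 * (1 / 2) ^ k) ^ (1 - θ) * (1000 * (k : ℝ) ^ 2) ^ θ ≤ C := by
  set r : ℝ := (1 / 2) ^ (1 - θ) with hr
  have hr0 : 0 < r := by positivity
  have hr1 : r < 1 := Real.rpow_lt_one (by norm_num) (by norm_num) (by linarith)
  obtain ⟨M, hM⟩ := (tendsto_pow_const_mul_const_pow_of_abs_lt_one 2
    (by rwa [abs_of_pos hr0] : |r| < 1)).bddAbove_range
  have hM' : ∀ k : ℕ, (k : ℝ) ^ 2 * r ^ k ≤ M := fun k => hM ⟨k, rfl⟩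
  have hMpos : 0 < M := lt_of_lt_of_le (by positivity) (hM' 1)
  refine ⟨(292 * Real.exp 8) ^ (1 - θ) * 1000 * M, by positivity, fun k hk => ?_⟩
  have hk' : (2 : ℝ) ≤ k := by exact_mod_cast hk
  have e1 : (292 * Real.exp 8 * (1 / 2) ^ k) ^ (1 - θ) = (292 * Real.exp 8) ^ (1 - θ) * r ^ k := by
    rw [Real.mul_rpow (by positivity) (by positivity), hr, ← Real.rpow_natCast,
      ← Real.rpow_natCast, ← Real.rpow_mul (by norm_num), ← Real.rpow_mul (by norm_num),
      mul_comm (k : ℝ)]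
  have e2 : (1000 * (k : ℝ) ^ 2) ^ θ ≤ 1000 * (k : ℝ) ^ 2 := by
    refine (Real.rpow_le_rpow_of_exponent_le (by nlinarith) h1.le).trans_eq (Real.rpow_one _)
  rw [e1]
  calc (292 * Real.exp 8) ^ (1 - θ) * r ^ k * (1000 * (k : ℝ) ^ 2) ^ θ
      ≤ (292 * Real.exp 8) ^ (1 - θ) * r ^ k * (1000 * (k : ℝ) ^ 2) := by gcongr
    _ = (292 * Real.exp 8) ^ (1 - θ) * 1000 * ((k : ℝ) ^ 2 * r ^ k) := by ring
    _ ≤ _ := by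
        gcongr
        exact hM' k

/-- The weight of the `ℓ_2` bound in the interpolation that gives the bound on `ℓ_q`. -/
noncomputable def interpolationWeight (q : ℝ) : ℝ := if 2 ≤ q then 2 / q else 2 - 2 / q

/-- Away from `q = 2` the interpolated constants are bounded in `k`; at `q = 2` the `ℓ_2` bound
enters with full weight and the constant is allowed to depend on `k`. -/
theorem exists_constants :
    ∃ A : ℕ → ℝ → ℝ, (∀ k q, 0 < A k q) ∧ (∀ k k' q, q ≠ 2 → A k q = A k' q) ∧
      ∀ (k : ℕ) (q : ℝ), 2 ≤ k → 1 ≤ q →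
        (292 * Real.exp 8 * (1 / 2) ^ k) ^ (1 - interpolationWeight q) *
          (1000 * (k : ℝ) ^ 2) ^ interpolationWeight q ≤ A k q := by
  have hex : ∀ q : ℝ, ∃ C : ℝ, 0 < C ∧ (1 ≤ q → q ≠ 2 → ∀ k : ℕ, 2 ≤ k →
      (292 * Real.exp 8 * (1 / 2) ^ k) ^ (1 - interpolationWeight q) *
        (1000 * (k : ℝ) ^ 2) ^ interpolationWeight q ≤ C) := by
    intro q
    by_cases hq : 1 ≤ q ∧ q ≠ 2
    · have hθ : interpolationWeight q < 1 := by
        rw [interpolationWeight]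
        split_ifs with h2
        · exact (div_lt_one (by linarith)).2 (lt_of_le_of_ne h2 hq.2.symm)
        · have h3 : 1 < 2 / q := (one_lt_div (by linarith)).2 (not_le.1 h2)
          linarith
      obtain ⟨C, hC, h⟩ := exists_interpolated_constant hθ
      exact ⟨C, hC, fun _ _ => h⟩
    · exact ⟨1, one_pos, fun h1 h2 => absurd ⟨h1, h2⟩ hq⟩
  choose C hC hCle using hex
  refine ⟨fun k q => if q = 2 then 1000 * (k : ℝ) ^ 2 + 1 else C q, fun k q => ?_,
    fun k k' q hq => by simp [hq], fun k q hk hq => ?_⟩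
  · dsimp only
    split_ifs
    · positivity
    · exact hC q
  · dsimp only
    split_ifs with h
    · subst h
      have : interpolationWeight 2 = 1 := by simp [interpolationWeight]
      rw [this, sub_self, Real.rpow_zero, Real.rpow_one]
      linarith
    · exact hCle q hq h k hk

theorem theorem2p5 :
    ∃ A : ℕ → ℝ → ℝ,
      (∀ k q, 0 < A k q) ∧
      (∀ k k' q, q ≠ 2 → A k q = A k' q) ∧
      ∀ (k n : ℕ), 2 ≤ k →
        ∀ S : Finset (Finset (Fin n)), IsPartialSteinerSystem (k - 1) k n S →
          ∃ c : Finset (Fin n) → ℤ,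
            (∀ J ∈ S, c J = 1 ∨ c J = -1) ∧
            (∀ q : ℝ, 2 ≤ q →
              polyNorm (ENNReal.ofReal q) (steinerPolynomial S c) ≤
                A k q * (Real.log (n : ℝ) ^ (3 / q) *
                  (n : ℝ) ^ ((k : ℝ) / 2 * ((q - 2) / q)))) ∧
            (∀ q : ℝ, 1 ≤ q → q ≤ 2 →
              polyNorm (ENNReal.ofReal q) (steinerPolynomial S c) ≤
                A k q * Real.log (n : ℝ) ^ ((3 * q - 3) / q)) := by
  obtain ⟨A, hA, hAk, hAle⟩ := exists_constants
  refine ⟨A, hA, hAk, fun k n hk S hS => ?_⟩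
  have hlog : 0 ≤ Real.log (n : ℝ) := Real.log_natCast_nonneg n
  have hR1 : ∀ q : ℝ, 0 ≤ A k q * (Real.log (n : ℝ) ^ (3 / q) *
      (n : ℝ) ^ ((k : ℝ) / 2 * ((q - 2) / q))) := fun q =>
    mul_nonneg (hA k q).le (mul_nonneg (Real.rpow_nonneg hlog _)
      (Real.rpow_nonneg (Nat.cast_nonneg n) _))
  have hR2 : ∀ q : ℝ, 0 ≤ A k q * Real.log (n : ℝ) ^ ((3 * q - 3) / q) := fun q =>
    mul_nonneg (hA k q).le (Real.rpow_nonneg hlog _)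
  rcases lt_or_ge n 2 with hn | hn
  · -- A set with at least two elements does not fit into `Fin n`, so the polynomial is zero.
    have hempty : S = ∅ := Finset.eq_empty_of_forall_notMem fun J hJ => by
      have h1 := hS.1 J hJ
      have h2 := card_finset_fin_le J
      omega
    have hzero : ∀ z, signedSum S (fun _ => 1) z = 0 := fun z => by simp [signedSum, hempty]
    refine ⟨fun J => ((1 : ℤˣ) : ℤ), fun J _ => Or.inl rfl, fun q hq => ?_, fun q hq _ => ?_⟩
    · exact polyNorm_steinerPolynomial_le S (fun _ => 1) (by linarith) (hR1 q)
        fun z _ => by rw [hzero, norm_zero]; exact hR1 q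
    · exact polyNorm_steinerPolynomial_le S (fun _ => 1) hq (hR2 q)
        fun z _ => by rw [hzero, norm_zero]; exact hR2 q
  · obtain ⟨c, h1, h2, hinf⟩ := exists_signs hk hn hS
    have hn0 : (0 : ℝ) ≤ n := Nat.cast_nonneg n
    refine ⟨fun J => (c J : ℤ), fun J _ => ?_, fun q hq => ?_, fun q hq hq2 => ?_⟩
    · rcases Int.units_eq_one_or (c J) with h | h <;> simp [h]
    · refine polyNorm_steinerPolynomial_le S c (by linarith) (hR1 q) fun z hz => ?_
      refine (norm_signedSum_le_of_two_le S c hq hinf h2 hz).trans ?_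
      have hAq := hAle k q hk (by linarith)
      rw [interpolationWeight, if_pos hq] at hAq
      rw [Real.mul_rpow (by positivity) (by positivity),
        Real.mul_rpow (x := 1000 * (k : ℝ) ^ 2) (by positivity) (by positivity),
        ← Real.rpow_mul hn0, ← Real.rpow_mul hlog,
        (by ring : (3 / 2 : ℝ) * (2 / q) = 3 / q),
        (by field_simp : (1 : ℝ) - 2 / q = (q - 2) / q)]
      rw [(by field_simp : (1 : ℝ) - 2 / q = (q - 2) / q)] at hAq
      calc _ = (292 * Real.exp 8 * (1 / 2) ^ k) ^ ((q - 2) / q) *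
            (1000 * (k : ℝ) ^ 2) ^ (2 / q) * (Real.log (n : ℝ) ^ (3 / q) *
              (n : ℝ) ^ ((k : ℝ) / 2 * ((q - 2) / q))) := by ring
        _ ≤ _ := by gcongr
    · refine polyNorm_steinerPolynomial_le S c hq (hR2 q) fun z hz => ?_
      refine (norm_signedSum_le_of_le_two S c hq hq2 h1 h2 hz).trans ?_
      have hAq := hAle k q hk hq
      have hw : interpolationWeight q = 2 - 2 / q := by
        rw [interpolationWeight]
        split_ifs with h
        · have : q = 2 := le_antisymm hq2 h
          subst this
          norm_num
        · rfl
      rw [hw] at hAq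
      rw [Real.mul_rpow (x := 1000 * (k : ℝ) ^ 2) (by positivity) (by positivity),
        ← Real.rpow_mul hlog, (by field_simp : (3 / 2 : ℝ) * (2 - 2 / q) = (3 * q - 3) / q),
        ← mul_assoc]
      gcongr
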